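/- For a finite set $V$, $d\in\mathbb N$ and $p\in[0,1]$, the binomial random subcube intersection graph $G_{V,d,p}$ is the random graph on $V$ defined as follows: each vertex $v\in V$ receives a random vector $f(v)\in\{0,1,\star\}^d$, where all coordinates of all vectors are independent, each being $\star$ with probability $p$ and $0$ or $1$ with probability $\frac{1-p}{2}$ each; $f(v)$ is identified with the subcube of $\{0,1\}^d$ consisting of the points that agree with $f(v)$ in all coordinates different from $\star$; distinct vertices $u,v$ are adjacent if and only if the subcubes $f(u)$ and $f(v)$ intersect. Write $[n]$ for an $n$-element vertex set. For a finite graph $G$ on $V$, write $e_G(S)$ for the number of edges of $G$ with both ends in $S\subseteq V$. For real numbers $q$ and $\delta$, say that $G$ is quasirandom with density parameter $q$ and error $\delta$ if $\bigl|e_G(S)-\tfrac{q}{2}|S|^2\bigr|\le\delta|V|^2$ for every $S\subseteq V$. (A sequence of graphs is quasirandom, in the sense of Chung, Graham and Wilson, if the error can be taken to be $o(1)$.) **Proposition.** Let $(\varepsilon(d))_{d\in\mathbb N}$ be a sequence of reals in $[0,1]$ such that, for some constants $0<c\le C<\infty$, one has $c\le\varepsilon(d)^2d\le C$ for all sufficiently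 large $d$. Then, with high probability as $d\to\infty$ and $n\to\infty$, the graph $G_{[n],d,1-\varepsilon(d)}$ is quasirandom with density parameter $e^{-\varepsilon(d)^2d/2}$. That is, for every $\delta>0$, $$\mathbb P\bigl(G_{[n],d,1-\varepsilon(d)}\text{ is quasirandom with density parameter }e^{-\varepsilon(d)^2d/2}\text{ and error }\delta\bigr)\longrightarrow 1$$ as $d$ and $n$ tend to infinity, independently of each other (with no relation between their rates of growth). -/

import Mathlib

open Filter Topology MeasureTheory

namespace SubcubeGraph

/-- A subcube of the hypercube `Q_d = {0,1}^d`, encoded as a vector of `{0,1,⋆}^d`: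
`some b` is a coordinate fixed to the bit `b`, and `none` is a free coordinate `⋆`. -/
abbrev Code (d : ℕ) : Type := Fin d → Option Bool

/-- The subcube of `Q_d = {0,1}^d` encoded by `x`, as a set of points. -/
def subcube {d : ℕ} (x : Code d) : Set (Fin d → Bool) :=
  {ω | ∀ i b, x i = some b → ω i = b}

/-- The subcube intersection graph of a family of feature subcubes: two distinct vertices are
adjacent when their feature subcubes have non-empty intersection. -/
def intersectionGraph {V : Type*} {d : ℕ} (f : V → Code d) : SimpleGraph V where
  Adj u v := u ≠ v ∧ (subcube (f u) ∩ subcube (f v)).Nonempty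
  symm := ⟨fun _ _ h => ⟨h.1.symm, by rw [Set.inter_comm]; exact h.2⟩⟩
  loopless := ⟨fun _ h => h.1 rfl⟩

instance instMeasurableSpaceOptionBool : MeasurableSpace (Option Bool) := ⊤

instance instDiscreteMeasurableSpaceOptionBool : DiscreteMeasurableSpace (Option Bool) :=
  ⟨fun _ => trivial⟩

/-- The law of one coordinate of a binomial random subcube: `⋆` with probability `p`,
and each of `0` and `1` with probability `(1 - p) / 2`. -/
noncomputable def coordLaw (p : unitInterval) : PMF (Option Bool) :=
  PMF.ofFintype
    (fun x => match x with
      | none => ENNReal.ofReal p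
      | some _ => ENNReal.ofReal ((1 - p) / 2))
    (by
      have h0 : (0 : ℝ) ≤ p := p.2.1
      have h1 : (0 : ℝ) ≤ (1 - p) / 2 := by have := p.2.2; linarith
      rw [Fintype.sum_option, Fintype.sum_bool, ← ENNReal.ofReal_add h1 h1,
        ← ENNReal.ofReal_add h0 (add_nonneg h1 h1)]
      simp)

/-- The law of the feature subcubes in the binomial model on the vertex set `V`: all coordinates
of all feature subcubes are independent with law `coordLaw p`. The random graph `G_{V,d,p}` is
`intersectionGraph f` for `f` drawn from this law. -/
noncomputable def binomialLaw (V : Type*) [Fintype V] (d : ℕ) (p : unitInterval) :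
    Measure (V → Code d) :=
  Measure.pi fun _ : V => Measure.pi fun _ : Fin d => (coordLaw p).toMeasure

open Classical in
/-- Quasirandomness with density parameter `q` and error `δ` (uniform edge distribution):
every vertex set `S` spans `q |S|^2 / 2` edges up to an error of at most `δ |V|^2`.
Here `G.interedges S S` is the set of ordered pairs of adjacent vertices of `S`, so half its
cardinality is the number of edges inside `S`. A sequence of graphs is quasirandom when
the error can be taken to be `o(1)`. -/
def IsQuasirandom {V : Type*} [Fintype V] (G : SimpleGraph V) (q δ : ℝ) : Prop :=
  ∀ S : Finset V,
    |((G.interedges S S).card : ℝ) / 2 - q * (S.card : ℝ) ^ 2 / 2| ≤ δ * (Fintype.card V : ℝ) ^ 2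

end SubcubeGraph

/-!
Put `ρ = (1 - ε² / 2) ^ d`, the probability that two independent random subcubes intersect, and let
`g x y = agree x y - ρ`, where `agree x y ∈ {0, 1}` says whether the subcubes `x` and `y` meet. Up to
the diagonal, `∑_{u, v ∈ S} g (f u) (f v)` is twice the number of edges inside `S` minus `ρ |S|²`.
Two applications of the Cauchy–Schwarz inequality (`sum_pow_four_le`) bound the fourth power of this
sum, simultaneously for all `S`, by `n⁴` times the weighted count of 4-cycles
`∑_{v, w, u, u'} g (f u) (f v) * g (f u) (f w) * g (f u') (f v) * g (f u') (f w)`.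
It therefore suffices to show that this count is `o(n⁴)` in expectation and to apply Markov's
inequality.

The quadruples with a repeated vertex contribute at most `6 n³`. For four distinct vertices, expand
the product of the four factors `agree - ρ`. As `agree` is a product over the coordinates, and these
are independent, each term of the expansion is `± ρ ^ j` times the `d`-th power of a one-coordinate
expectation (`integral_prod_four`). That expectation is an explicit polynomial in `ε`, and it agrees
with the `(4 - j)`-th power of `1 - ε² / 2` up to `2 ε³` (`abs_four_cycle_sub_prod_le`). Were the
agreement exact, the expansion would collapse to `(ρ - ρ)⁴ = 0`; so the expectation is at most
`32 d ε³` (`integral_four_cycle_le`). Since `ε² d` stays bounded, `ε → 0` and `d ε³ → 0`. For the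
same reason `ρ - exp (-ε² d / 2) → 0` (`abs_one_sub_pow_sub_exp_le`), and `ρ` may be replaced by the
required density.
-/

namespace SubcubeGraph

open ProbabilityTheory

/-! ### Edge discrepancy and weighted 4-cycles -/

/-- The left side involves an arbitrary set `S`, the right side does not: a bound on the single sum
over all 4-cycles `v u w u'` controls every `S` at once. -/
theorem sum_pow_four_le {V : Type*} [Fintype V] (a : V → V → ℝ) (S : Finset V) :
    (∑ u ∈ S, ∑ v ∈ S, a u v) ^ 4 ≤
      (Fintype.card V : ℝ) ^ 4 *
        ∑ v, ∑ w, ∑ u, ∑ u', a u v * a u w * (a u' v * a u' w) := by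
  set n : ℝ := (Fintype.card V : ℝ) with hn
  have hS : (S.card : ℝ) ≤ n := by rw [hn]; exact_mod_cast Finset.card_le_univ S
  have h0 : (0 : ℝ) ≤ S.card := by positivity
  have h1 : (∑ u ∈ S, ∑ v ∈ S, a u v) ^ 2 ≤ n * ∑ v ∈ S, ∑ w ∈ S, ∑ u, a u v * a u w := by
    calc (∑ u ∈ S, ∑ v ∈ S, a u v) ^ 2
        ≤ S.card * ∑ u ∈ S, (∑ v ∈ S, a u v) ^ 2 := sq_sum_le_card_mul_sum_sq
      _ ≤ n * ∑ u, (∑ v ∈ S, a u v) ^ 2 := by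
          gcongr
          exact Finset.subset_univ S
      _ = n * ∑ v ∈ S, ∑ w ∈ S, ∑ u, a u v * a u w := by
          congr 1
          simp_rw [sq, Finset.sum_mul_sum]
          rw [Finset.sum_comm]
          refine Finset.sum_congr rfl fun v _ => ?_
          rw [Finset.sum_comm]
  have h2 : (∑ v ∈ S, ∑ w ∈ S, ∑ u, a u v * a u w) ^ 2 ≤
      n ^ 2 * ∑ v, ∑ w, (∑ u, a u v * a u w) ^ 2 := by
    rw [← Finset.sum_product' S S (fun v w => ∑ u, a u v * a u w),
      ← Finset.sum_product' Finset.univ Finset.univ (fun v w => (∑ u, a u v * a u w) ^ 2)]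
    refine (sq_sum_le_card_mul_sum_sq).trans ?_
    rw [Finset.card_product, Nat.cast_mul, ← sq]
    gcongr <;> exact Finset.subset_univ _
  calc (∑ u ∈ S, ∑ v ∈ S, a u v) ^ 4
      = ((∑ u ∈ S, ∑ v ∈ S, a u v) ^ 2) ^ 2 := by ring
    _ ≤ (n * ∑ v ∈ S, ∑ w ∈ S, ∑ u, a u v * a u w) ^ 2 := by gcongr
    _ = n ^ 2 * (∑ v ∈ S, ∑ w ∈ S, ∑ u, a u v * a u w) ^ 2 := by ring
    _ ≤ n ^ 2 * (n ^ 2 * ∑ v, ∑ w, (∑ u, a u v * a u w) ^ 2) := by gcongr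
    _ = _ := by
      simp_rw [sq (∑ u, a u _ * a u _), Finset.sum_mul_sum]
      ring

/-! ### Intersecting subcubes -/

/-- The indicator that two coordinates are fixed to opposite bits. -/
def clash : Option Bool → Option Bool → ℝ
  | some a, some b => if a = b then 0 else 1
  | _, _ => 0

/-- The indicator that two subcubes intersect, as a product over the coordinates. -/
def agree {d : ℕ} (x y : Code d) : ℝ := ∏ i, (1 - clash (x i) (y i))

theorem clash_eq (a b : Option Bool) : clash a b = 0 ∨ clash a b = 1 := by
  rcases a with _ | a <;> rcases b with _ | b <;> simp [clash]
  cases a <;> cases b <;> simp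

theorem agree_self {d : ℕ} (x : Code d) : agree x x = 1 := by
  refine Finset.prod_eq_one fun i _ => ?_
  rcases x i with _ | a <;> simp [clash]

open Classical in
theorem agree_eq_ite {d : ℕ} (x y : Code d) :
    agree x y = if (subcube x ∩ subcube y).Nonempty then 1 else 0 := by
  split_ifs with h
  · obtain ⟨ω, hx, hy⟩ := h
    refine Finset.prod_eq_one fun i _ => ?_
    have h1 := hx i
    have h2 := hy i
    rcases hxi : x i with _ | a <;> rcases hyi : y i with _ | b <;> simp [clash]
    rw [← h1 a hxi, ← h2 b hyi]
  · by_contra hne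
    refine h ⟨fun i => (x i).getD ((y i).getD false), fun i b hb => by simp [hb], fun i b hb => ?_⟩
    have hi := Finset.prod_ne_zero_iff.1 hne i (Finset.mem_univ i)
    rcases hxi : x i with _ | a
    · simp [hxi, hb]
    · simp only [hxi, hb, clash] at hi
      by_cases hab : a = b
      · simp [hxi, hab]
      · simp [hab] at hi

/-- The one-coordinate expectation attached to the 4-cycle `a c b e`, whose edges are switched on and
off by `s`, `t`, `q`, `r`. Two edges sharing a vertex clash simultaneously with probability
`p ^ 3 / 4`, two opposite edges with probability `p ^ 4 / 4`, and three or four edges with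
probability `p ^ 4 / 8`. -/
theorem sum_option_bool_four (p : ℝ) (s t q r : ℝ) :
    let w : Option Bool → ℝ := fun x => x.elim (1 - p) fun _ => p / 2
    ∑ a, ∑ b, ∑ c, ∑ e, w a * w b * w c * w e *
      ((1 - s * clash c a) * (1 - t * clash c b) * ((1 - q * clash e a) * (1 - r * clash e b))) =
    1 - (s + t + q + r) * (p ^ 2 / 2) + (s * t + t * r + r * q + q * s) * (p ^ 3 / 4) +
      (s * r + t * q) * (p ^ 4 / 4) - (s * t * q + s * t * r + s * q * r + t * q * r) * (p ^ 4 / 8)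
      + s * t * q * r * (p ^ 4 / 8) := by
  simp only [Fintype.sum_option, Fintype.sum_bool, clash, Option.elim]
  simp
  ring

/-! ### Expectations over finitely many vertices -/

instance {V : Type*} [Fintype V] (d : ℕ) (p : unitInterval) :
    IsProbabilityMeasure (binomialLaw V d p) := by
  unfold binomialLaw; infer_instance

/-- The subcubes of distinct vertices `σ k` are again distributed by the binomial model. -/
theorem integral_binomialLaw_comp {V κ : Type*} [Fintype V] [Fintype κ] {d : ℕ}
    (p : unitInterval) {σ : κ → V} (hσ : Function.Injective σ) (F : (κ → Code d) → ℝ) :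
    ∫ f, F (f ∘ σ) ∂binomialLaw V d p = ∫ x, F x ∂binomialLaw κ d p := by
  have hmap : (binomialLaw V d p).map (fun f => f ∘ σ) = binomialLaw κ d p := by
    have h1 : iIndepFun (fun v (f : V → Code d) => f v) (binomialLaw V d p) :=
      iIndepFun_pi (X := fun _ => id) fun _ => aemeasurable_id
    have h2 := h1.precomp hσ
    rw [iIndepFun_iff_map_fun_eq_pi_map (fun k => (measurable_pi_apply _).aemeasurable)] at h2
    refine h2.trans ?_
    unfold binomialLaw
    congr 1
    funext k
    exact (measurePreserving_eval _ (σ k)).map_eq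
  rw [← hmap, integral_map (Measurable.of_discrete).aemeasurable
    (Measurable.of_discrete).aestronglyMeasurable]

/-- The expectation of a product over coordinates of one and the same function factorizes, by
independence of the coordinates. -/
theorem integral_binomialLaw_prod {κ : Type*} [Fintype κ] [DecidableEq κ] (d : ℕ) (p : unitInterval)
    (G : (κ → Option Bool) → ℝ) :
    ∫ x, ∏ i, G (fun k => x k i) ∂binomialLaw κ d p =
      (∑ z : κ → Option Bool, (∏ k, (coordLaw p (z k)).toReal) * G z) ^ d := by
  rw [integral_fintype .of_finite]
  have hw (x : κ → Code d) : (binomialLaw κ d p).real {x} =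
      ∏ k, ∏ i, (coordLaw p (x k i)).toReal := by
    simp [binomialLaw, measureReal_def, Measure.pi_singleton, ENNReal.toReal_prod]
  simp_rw [hw, smul_eq_mul]
  rw [Fintype.sum_pow]
  refine Fintype.sum_equiv (Equiv.piComm fun _ _ => Option Bool) _ _ fun x => ?_
  rw [Finset.prod_comm, ← Finset.prod_mul_distrib]
  rfl

theorem toReal_coordLaw_symm (ε : unitInterval) (x : Option Bool) :
    (coordLaw (unitInterval.symm ε) x).toReal = x.elim (1 - (ε : ℝ)) fun _ => (ε : ℝ) / 2 := by
  have h0 := ε.2.1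
  have h1 := ε.2.2
  rcases x with _ | b
  · simp [coordLaw, ENNReal.toReal_ofReal, h1]
  · simp [coordLaw, div_nonneg h0 zero_le_two]

/-- A function on `Fin 4` as the nested tuple of its four values. -/
def finFourEquiv (α : Type*) : (α × α × α × α) ≃ (Fin 4 → α) where
  toFun p := ![p.1, p.2.1, p.2.2.1, p.2.2.2]
  invFun z := (z 0, z 1, z 2, z 3)
  left_inv _ := rfl
  right_inv z := by ext i; fin_cases i <;> rfl

theorem integral_prod_four {V : Type*} [Fintype V] {d : ℕ} (ε : unitInterval) {v w u u' : V}
    (h : Function.Injective ![v, w, u, u']) (s t q r : ℝ) :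
    ∫ f, (∏ i, (1 - s * clash (f u i) (f v i))) * (∏ i, (1 - t * clash (f u i) (f w i))) *
        ((∏ i, (1 - q * clash (f u' i) (f v i))) * ∏ i, (1 - r * clash (f u' i) (f w i)))
      ∂binomialLaw V d (unitInterval.symm ε) =
    (1 - (s + t + q + r) * ((ε : ℝ) ^ 2 / 2) +
      (s * t + t * r + r * q + q * s) * ((ε : ℝ) ^ 3 / 4) +
      (s * r + t * q) * ((ε : ℝ) ^ 4 / 4) -
      (s * t * q + s * t * r + s * q * r + t * q * r) * ((ε : ℝ) ^ 4 / 8)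
      + s * t * q * r * ((ε : ℝ) ^ 4 / 8)) ^ d := by
  let G : (Fin 4 → Option Bool) → ℝ := fun z =>
    (1 - s * clash (z 2) (z 0)) * (1 - t * clash (z 2) (z 1)) *
      ((1 - q * clash (z 3) (z 0)) * (1 - r * clash (z 3) (z 1)))
  have h1 := integral_binomialLaw_comp (unitInterval.symm ε) h
    (fun x : Fin 4 → Code d => ∏ i, G fun k => x k i)
  rw [integral_binomialLaw_prod] at h1
  simp_rw [← Finset.prod_mul_distrib]
  refine h1.trans ?_
  congr 1
  rw [← (finFourEquiv _).sum_comp, Fintype.sum_prod_type]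
  simp_rw [Fintype.sum_prod_type, toReal_coordLaw_symm, Fin.prod_univ_four]
  exact sum_option_bool_four ε s t q r

/-! ### The expected weight of a 4-cycle on distinct vertices -/

theorem clash_mem_Icc (a b : Option Bool) : clash a b ∈ Set.Icc (0 : ℝ) 1 := by
  rcases clash_eq a b with h | h <;> simp [h]

theorem abs_prod_one_sub_mul_clash_le {d : ℕ} {s : ℝ} (hs : s ∈ Set.Icc (0 : ℝ) 1)
    (x y : Code d) : |∏ i, (1 - s * clash (x i) (y i))| ≤ 1 := by
  rw [Finset.abs_prod]
  refine Finset.prod_le_one (fun _ _ => abs_nonneg _) fun i _ => ?_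
  have h := unitInterval.mul_mem hs (clash_mem_Icc (x i) (y i))
  exact abs_le.2 ⟨by linarith [h.2], by linarith [h.1]⟩

theorem abs_pow_sub_pow_le_of_le_one {a b : ℝ} (ha : |a| ≤ 1) (hb : |b| ≤ 1) (d : ℕ) :
    |a ^ d - b ^ d| ≤ d * |a - b| := by
  refine (abs_pow_sub_pow_le a b d).trans ?_
  have h1 : max |a| |b| ^ (d - 1) ≤ 1 :=
    pow_le_one₀ (le_max_of_le_left (abs_nonneg a)) (max_le ha hb)
  calc |a - b| * d * max |a| |b| ^ (d - 1) ≤ |a - b| * d * 1 := by gcongr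
    _ = d * |a - b| := by ring

theorem abs_agree_sub_le {d : ℕ} {ρ : ℝ} (hρ : ρ ∈ Set.Icc (0 : ℝ) 1) (x y : Code d) :
    |agree x y - ρ| ≤ 1 := by
  have h : agree x y = 0 ∨ agree x y = 1 := by
    rw [agree_eq_ite]; split_ifs <;> simp
  rcases h with h | h <;> rw [h, abs_le] <;> constructor <;> linarith [hρ.1, hρ.2]

/-- The one-coordinate expectation is close to what it would be if the edges were independent: the
terms of order at most two in `e` coincide. -/
theorem abs_four_cycle_sub_prod_le {e : ℝ} (h0 : 0 ≤ e) (h1 : e ≤ 1) {s t q r : ℝ}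
    (hs : s = 0 ∨ s = 1) (ht : t = 0 ∨ t = 1) (hq : q = 0 ∨ q = 1) (hr : r = 0 ∨ r = 1) :
    |1 - (s + t + q + r) * (e ^ 2 / 2) + (s * t + t * r + r * q + q * s) * (e ^ 3 / 4) +
        (s * r + t * q) * (e ^ 4 / 4) -
        (s * t * q + s * t * r + s * q * r + t * q * r) * (e ^ 4 / 8)
        + s * t * q * r * (e ^ 4 / 8) -
      (1 - s * (e ^ 2 / 2)) * (1 - t * (e ^ 2 / 2)) *
        ((1 - q * (e ^ 2 / 2)) * (1 - r * (e ^ 2 / 2)))| ≤ 2 * e ^ 3 := by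
  have h3 : 0 ≤ e ^ 3 := by positivity
  have h6 : 0 ≤ e ^ 6 := by positivity
  have h8 : 0 ≤ e ^ 8 := by positivity
  have h43 : e ^ 4 ≤ e ^ 3 := pow_le_pow_of_le_one h0 h1 (by norm_num)
  have h64 : e ^ 6 ≤ e ^ 4 := pow_le_pow_of_le_one h0 h1 (by norm_num)
  have h84 : e ^ 8 ≤ e ^ 4 := pow_le_pow_of_le_one h0 h1 (by norm_num)
  rw [abs_le]
  rcases hs with rfl | rfl <;> rcases ht with rfl | rfl <;> rcases hq with rfl | rfl <;>
    rcases hr with rfl | rfl <;> constructor <;> ring_nf <;> linarith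

/-- The factors `agree - ρ` are nearly uncorrelated along a 4-cycle of distinct vertices. -/
theorem integral_four_cycle_le {V : Type*} [Fintype V] {d : ℕ} (ε : unitInterval) {v w u u' : V}
    (h : Function.Injective ![v, w, u, u']) {ρ : ℝ} (hρ : ρ = (1 - (ε : ℝ) ^ 2 / 2) ^ d) :
    ∫ f, (agree (f u) (f v) - ρ) * (agree (f u) (f w) - ρ) *
        ((agree (f u') (f v) - ρ) * (agree (f u') (f w) - ρ))
      ∂binomialLaw V d (unitInterval.symm ε) ≤ 32 * (d * (ε : ℝ) ^ 3) := by
  have h0 : (0 : ℝ) ≤ ε := ε.2.1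
  have h1 : (ε : ℝ) ≤ 1 := ε.2.2
  have hx : (ε : ℝ) ^ 2 / 2 ∈ Set.Icc (0 : ℝ) 1 :=
    ⟨by positivity, by linarith [pow_le_one₀ (n := 2) h0 h1]⟩
  have hρ' : ρ ∈ Set.Icc (0 : ℝ) 1 := by
    rw [hρ]
    exact ⟨pow_nonneg (by linarith [hx.2]) _, pow_le_one₀ (by linarith [hx.2]) (by linarith [hx.1])⟩
  -- Expansion: `agree x y - ρ = ∑ s ∈ {0, 1}, c s * ∏ i, (1 - s * clash (x i) (y i))`, where `s = 1`
  -- selects `agree x y` with coefficient `1` and `s = 0` selects `1` with coefficient `-ρ`.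
  let B : Finset ℝ := {0, 1}
  have hB (s : ℝ) (hs : s ∈ B) : s = 0 ∨ s = 1 := by simpa [B] using hs
  have hBI (s : ℝ) (hs : s ∈ B) : s ∈ Set.Icc (0 : ℝ) 1 := by
    rcases hB s hs with rfl | rfl <;> simp
  let c : ℝ → ℝ := fun s => s - (1 - s) * ρ
  have hc (s : ℝ) (hs : s ∈ B) : |c s| ≤ 1 := by
    rcases hB s hs with rfl | rfl <;> simp [c, abs_le]
    exact ⟨by linarith [hρ'.1], hρ'.2⟩
  let P : ℝ → Code d → Code d → ℝ := fun s x y => ∏ i, (1 - s * clash (x i) (y i))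
  have hP (x y : Code d) : agree x y - ρ = ∑ s ∈ B, c s * P s x y := by
    simp [B, c, P, agree]
    ring
  have hexp (A : ℝ → ℝ) (A₁ A₂ A₃ : ℝ → ℝ) :
      (∑ s ∈ B, c s * A s) * (∑ t ∈ B, c t * A₁ t) *
        ((∑ q ∈ B, c q * A₂ q) * (∑ r ∈ B, c r * A₃ r)) =
      ∑ s ∈ B, ∑ t ∈ B, ∑ q ∈ B, ∑ r ∈ B,
        c s * c t * (c q * c r) * (A s * A₁ t * (A₂ q * A₃ r)) := by
    rw [Finset.sum_mul_sum, Finset.sum_mul_sum, Finset.sum_mul]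
    refine Finset.sum_congr rfl fun s _ => ?_
    rw [Finset.sum_mul]
    refine Finset.sum_congr rfl fun t _ => ?_
    rw [Finset.mul_sum]
    refine Finset.sum_congr rfl fun q _ => ?_
    rw [Finset.mul_sum]
    refine Finset.sum_congr rfl fun r _ => ?_
    ring
  -- `Ψ` is the one-coordinate expectation; if the edges were independent, it would be a product of
  -- values of `Φ`.
  let Ψ : ℝ → ℝ → ℝ → ℝ → ℝ := fun s t q r =>
    1 - (s + t + q + r) * ((ε : ℝ) ^ 2 / 2) +
      (s * t + t * r + r * q + q * s) * ((ε : ℝ) ^ 3 / 4) +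
      (s * r + t * q) * ((ε : ℝ) ^ 4 / 4) -
      (s * t * q + s * t * r + s * q * r + t * q * r) * ((ε : ℝ) ^ 4 / 8)
      + s * t * q * r * ((ε : ℝ) ^ 4 / 8)
  let Φ : ℝ → ℝ := fun s => 1 - s * ((ε : ℝ) ^ 2 / 2)
  have hΦ (s : ℝ) (hs : s ∈ B) : |Φ s| ≤ 1 := by
    have := unitInterval.mul_mem (hBI s hs) hx
    simp only [Φ]
    exact abs_le.2 ⟨by linarith [this.2], by linarith [this.1]⟩
  have hΨ (s : ℝ) (hs : s ∈ B) (t : ℝ) (ht : t ∈ B) (q : ℝ) (hq : q ∈ B) (r : ℝ) (hr : r ∈ B) :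
      |Ψ s t q r| ≤ 1 := by
    -- For `d = 1`, `Ψ s t q r` is an expectation of a quantity in `[-1, 1]`.
    have := integral_prod_four (d := 1) ε h s t q r
    rw [pow_one] at this
    change _ = Ψ s t q r at this
    rw [← this, ← Real.norm_eq_abs]
    refine (norm_integral_le_of_norm_le_const (C := 1) (ae_of_all _ fun f => ?_)).trans (by simp)
    simp only [norm_mul, Real.norm_eq_abs]
    have k := fun s hs (x y : Code 1) => abs_prod_one_sub_mul_clash_le (hBI s hs) x y
    exact mul_le_one₀ (mul_le_one₀ (k s hs _ _) (abs_nonneg _) (k t ht _ _)) (by positivity)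
      (mul_le_one₀ (k q hq _ _) (abs_nonneg _) (k r hr _ _))
  have hint : ∫ f, (agree (f u) (f v) - ρ) * (agree (f u) (f w) - ρ) *
        ((agree (f u') (f v) - ρ) * (agree (f u') (f w) - ρ))
      ∂binomialLaw V d (unitInterval.symm ε) =
      ∑ s ∈ B, ∑ t ∈ B, ∑ q ∈ B, ∑ r ∈ B, c s * c t * (c q * c r) * Ψ s t q r ^ d := by
    simp_rw [hP, hexp]
    rw [integral_finsetSum _ fun _ _ => .of_finite]
    refine Finset.sum_congr rfl fun s _ => ?_
    rw [integral_finsetSum _ fun _ _ => .of_finite]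
    refine Finset.sum_congr rfl fun t _ => ?_
    rw [integral_finsetSum _ fun _ _ => .of_finite]
    refine Finset.sum_congr rfl fun q _ => ?_
    rw [integral_finsetSum _ fun _ _ => .of_finite]
    refine Finset.sum_congr rfl fun r _ => ?_
    rw [integral_const_mul, integral_prod_four ε h]
  -- With the idealized expectations the expansion factorizes, and each factor is `ρ - ρ`.
  have hzero : ∑ s ∈ B, ∑ t ∈ B, ∑ q ∈ B, ∑ r ∈ B,
      c s * c t * (c q * c r) * (Φ s * Φ t * (Φ q * Φ r)) ^ d = 0 := by
    simp_rw [mul_pow]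
    rw [← hexp (fun s => Φ s ^ d) (fun s => Φ s ^ d) (fun s => Φ s ^ d) (fun s => Φ s ^ d)]
    have : ∑ s ∈ B, c s * Φ s ^ d = 0 := by simp [B, c, Φ, hρ]
    rw [this, zero_mul, zero_mul]
  rw [hint, ← sub_zero (∑ s ∈ B, _), ← hzero]
  simp_rw [← Finset.sum_sub_distrib, ← mul_sub]
  have hterm (s : ℝ) (hs : s ∈ B) (t : ℝ) (ht : t ∈ B) (q : ℝ) (hq : q ∈ B) (r : ℝ) (hr : r ∈ B) :
      c s * c t * (c q * c r) * (Ψ s t q r ^ d - (Φ s * Φ t * (Φ q * Φ r)) ^ d) ≤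
        d * (2 * (ε : ℝ) ^ 3) := by
    refine (le_abs_self _).trans ?_
    rw [abs_mul]
    have hcc : |c s * c t * (c q * c r)| ≤ 1 := by
      simp only [abs_mul]
      exact mul_le_one₀ (mul_le_one₀ (hc s hs) (abs_nonneg _) (hc t ht)) (by positivity)
        (mul_le_one₀ (hc q hq) (abs_nonneg _) (hc r hr))
    have hΦΦ : |Φ s * Φ t * (Φ q * Φ r)| ≤ 1 := by
      simp only [abs_mul]
      exact mul_le_one₀ (mul_le_one₀ (hΦ s hs) (abs_nonneg _) (hΦ t ht)) (by positivity)
        (mul_le_one₀ (hΦ q hq) (abs_nonneg _) (hΦ r hr))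
    have hd := abs_pow_sub_pow_le_of_le_one (hΨ s hs t ht q hq r hr) hΦΦ d
    have hdiff := abs_four_cycle_sub_prod_le h0 h1 (hB s hs) (hB t ht) (hB q hq) (hB r hr)
    calc _ ≤ 1 * |Ψ s t q r ^ d - (Φ s * Φ t * (Φ q * Φ r)) ^ d| := by gcongr
      _ ≤ d * |Ψ s t q r - Φ s * Φ t * (Φ q * Φ r)| := by rwa [one_mul]
      _ ≤ _ := by gcongr
  calc _ ≤ ∑ s ∈ B, ∑ t ∈ B, ∑ q ∈ B, ∑ r ∈ B, d * (2 * (ε : ℝ) ^ 3) :=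
        Finset.sum_le_sum fun s hs => Finset.sum_le_sum fun t ht => Finset.sum_le_sum fun q hq =>
          Finset.sum_le_sum fun r hr => hterm s hs t ht q hq r hr
    _ = _ := by
      have hcard : B.card = 2 := by simp [B]
      simp only [Finset.sum_const, hcard, nsmul_eq_mul]
      ring

/-! ### The expected 4-cycle sum -/

/-- The sum over all closed walks `v u w u'` of length four, repeated vertices allowed, of the product
of the edge weights `agree - ρ`. -/
noncomputable def fourCycleSum {V : Type*} [Fintype V] {d : ℕ} (ρ : ℝ) (f : V → Code d) : ℝ :=
  ∑ v, ∑ w, ∑ u, ∑ u', (agree (f u) (f v) - ρ) * (agree (f u) (f w) - ρ) *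
    ((agree (f u') (f v) - ρ) * (agree (f u') (f w) - ρ))

/-- Quadruples with a repeated vertex are bounded trivially: each of the six possible coincidences
accounts for `n ^ 3` of them. -/
theorem integral_fourCycleSum_le {V : Type*} [Fintype V] (d : ℕ) (ε : unitInterval) :
    ∫ f, fourCycleSum ((1 - (ε : ℝ) ^ 2 / 2) ^ d) f ∂binomialLaw V d (unitInterval.symm ε) ≤
      32 * (d * (ε : ℝ) ^ 3) * (Fintype.card V : ℝ) ^ 4 + 6 * (Fintype.card V : ℝ) ^ 3 := by
  classical
  have h0 : (0 : ℝ) ≤ ε := ε.2.1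
  have h1 : (ε : ℝ) ≤ 1 := ε.2.2
  have hx : (ε : ℝ) ^ 2 ≤ 1 := pow_le_one₀ h0 h1
  set ρ : ℝ := (1 - (ε : ℝ) ^ 2 / 2) ^ d with hρ
  have hρ' : ρ ∈ Set.Icc (0 : ℝ) 1 :=
    ⟨pow_nonneg (by linarith) _, pow_le_one₀ (by linarith) (by linarith [sq_nonneg (ε : ℝ)])⟩
  have hquad (v w u u' : V) :
      ∫ f, (agree (f u) (f v) - ρ) * (agree (f u) (f w) - ρ) *
        ((agree (f u') (f v) - ρ) * (agree (f u') (f w) - ρ))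
        ∂binomialLaw V d (unitInterval.symm ε) ≤
      32 * (d * (ε : ℝ) ^ 3) + ((if v = w then 1 else 0) + (if v = u then 1 else 0) +
        (if v = u' then 1 else 0) + (if w = u then 1 else 0) + (if w = u' then 1 else 0) +
        (if u = u' then 1 else 0)) := by
    by_cases h : Function.Injective ![v, w, u, u']
    · refine (integral_four_cycle_le ε h hρ).trans (le_add_of_nonneg_right ?_)
      positivity
    · have hle : ∫ f, (agree (f u) (f v) - ρ) * (agree (f u) (f w) - ρ) *
          ((agree (f u') (f v) - ρ) * (agree (f u') (f w) - ρ))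
          ∂binomialLaw V d (unitInterval.symm ε) ≤ 1 := by
        refine (Real.le_norm_self _).trans
          ((norm_integral_le_of_norm_le_const (C := 1) (ae_of_all _ fun f => ?_)).trans (by simp))
        simp only [norm_mul, Real.norm_eq_abs]
        have k := fun x y : Code d => abs_agree_sub_le hρ' x y
        exact mul_le_one₀ (mul_le_one₀ (k _ _) (abs_nonneg _) (k _ _)) (by positivity)
          (mul_le_one₀ (k _ _) (abs_nonneg _) (k _ _))
      refine hle.trans (le_trans ?_ (le_add_of_nonneg_left (by positivity)))
      contrapose! h
      have hne : v ≠ w ∧ v ≠ u ∧ v ≠ u' ∧ w ≠ u ∧ w ≠ u' ∧ u ≠ u' := by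
        have hI (a b : V) : (0 : ℝ) ≤ if a = b then 1 else 0 := by positivity
        refine ⟨?_, ?_, ?_, ?_, ?_, ?_⟩ <;> intro heq <;> rw [if_pos heq] at h <;>
          linarith [hI v w, hI v u, hI v u', hI w u, hI w u', hI u u']
      obtain ⟨a1, a2, a3, a4, a5, a6⟩ := hne
      intro i j hij
      fin_cases i <;> fin_cases j <;> simp_all [eq_comm]
  unfold fourCycleSum
  rw [integral_finsetSum _ fun _ _ => .of_finite]
  calc _ ≤ ∑ v : V, ∑ w : V, ∑ u : V, ∑ u' : V,
        (32 * (d * (ε : ℝ) ^ 3) + ((if v = w then 1 else 0) + (if v = u then 1 else 0) +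
        (if v = u' then 1 else 0) + (if w = u then 1 else 0) + (if w = u' then 1 else 0) +
        (if u = u' then 1 else 0))) := by
        refine Finset.sum_le_sum fun v _ => ?_
        rw [integral_finsetSum _ fun _ _ => .of_finite]
        refine Finset.sum_le_sum fun w _ => ?_
        rw [integral_finsetSum _ fun _ _ => .of_finite]
        refine Finset.sum_le_sum fun u _ => ?_
        rw [integral_finsetSum _ fun _ _ => .of_finite]
        exact Finset.sum_le_sum fun u' _ => hquad v w u u'
    _ = _ := by
        simp [Finset.sum_add_distrib]
        ring

/-! ### Quasirandomness -/

open Classical in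
/-- The sum on the right has diagonal terms `1`, while the graph has no loops. -/
theorem card_interedges_add_card {V : Type*} {d : ℕ} (f : V → Code d) (S : Finset V) :
    (((intersectionGraph f).interedges S S).card : ℝ) + S.card =
      ∑ u ∈ S, ∑ v ∈ S, agree (f u) (f v) := by
  have h (u v : V) : agree (f u) (f v) =
      (if (intersectionGraph f).Adj u v then 1 else 0) + if u = v then 1 else 0 := by
    by_cases huv : u = v
    · subst huv; simp [agree_self]
    · simp [agree_eq_ite, intersectionGraph, huv]
  simp_rw [h, Finset.sum_add_distrib]
  congr 1
  · rw [SimpleGraph.interedges, Rel.interedges, Finset.card_filter, Finset.sum_product]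
    push_cast
    rfl
  · simp

/-- A small 4-cycle sum forces quasirandomness. The error `δ` absorbs the discrepancy, the change of
density from `ρ` to `q`, and the diagonal, which is negligible once `n ≥ 2 / δ`. -/
theorem isQuasirandom_of_fourCycleSum_lt {V : Type*} [Fintype V] {d : ℕ} {f : V → Code d}
    {q ρ δ : ℝ} (hδ : 0 < δ) (hρ : |ρ - q| ≤ δ / 2) (hn : 2 / δ ≤ Fintype.card V)
    (hf : fourCycleSum ρ f < δ ^ 4 * (Fintype.card V : ℝ) ^ 4) :
    IsQuasirandom (intersectionGraph f) q δ := by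
  intro S
  have h4 := sum_pow_four_le (fun u v => agree (f u) (f v) - ρ) S
  have hSn : (S.card : ℝ) ≤ Fintype.card V := by exact_mod_cast Finset.card_le_univ S
  set n : ℝ := (Fintype.card V : ℝ)
  set s : ℝ := (S.card : ℝ)
  have hs : 0 ≤ s := by positivity
  have hn0 : 0 < n := lt_of_lt_of_le (by positivity) hn
  have hsum : ∑ u ∈ S, ∑ v ∈ S, (agree (f u) (f v) - ρ) =
      ∑ u ∈ S, ∑ v ∈ S, agree (f u) (f v) - s ^ 2 * ρ := by
    simp only [Finset.sum_sub_distrib, Finset.sum_const, nsmul_eq_mul]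
    ring
  have habs : |∑ u ∈ S, ∑ v ∈ S, agree (f u) (f v) - s ^ 2 * ρ| ≤ δ * n ^ 2 := by
    rw [← hsum]
    refine le_of_pow_le_pow_left₀ (n := 4) (by norm_num) (by positivity) ?_
    rw [Even.pow_abs ⟨2, rfl⟩]
    refine h4.trans ?_
    calc n ^ 4 * fourCycleSum ρ f ≤ n ^ 4 * (δ ^ 4 * n ^ 4) := by gcongr
      _ = _ := by ring
  rw [← card_interedges_add_card] at habs
  have hsn : s ≤ δ / 2 * n ^ 2 := by
    have : 2 ≤ n * δ := (div_le_iff₀ hδ).1 hn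
    nlinarith
  have hρs : |s ^ 2 * (ρ - q)| ≤ δ / 2 * n ^ 2 := by
    rw [abs_mul, abs_of_nonneg (sq_nonneg s), mul_comm]
    gcongr
  rw [abs_le] at habs hρs ⊢
  constructor <;> linarith [habs.1, habs.2, hρs.1, hρs.2]

theorem abs_one_sub_pow_sub_exp_le {e : ℝ} (h0 : 0 ≤ e) (h1 : e ≤ 1) (d : ℕ) :
    |(1 - e ^ 2 / 2) ^ d - Real.exp (-(e ^ 2 * d / 2))| ≤ d * e ^ 3 := by
  have hx : e ^ 2 ≤ 1 := pow_le_one₀ h0 h1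
  have hx0 := sq_nonneg e
  have hexp : Real.exp (-(e ^ 2 * d / 2)) = Real.exp (-(e ^ 2 / 2)) ^ d := by
    rw [← Real.exp_nat_mul]; congr 1; ring
  rw [hexp]
  refine (abs_pow_sub_pow_le_of_le_one (abs_le.2 ⟨by linarith, by linarith⟩) ?_ d).trans ?_
  · rw [Real.abs_exp]
    exact Real.exp_le_one_iff.2 (by linarith)
  · gcongr
    have h := Real.abs_exp_sub_one_sub_id_le (x := -(e ^ 2 / 2))
      (abs_le.2 ⟨by linarith, by linarith⟩)
    rw [abs_sub_comm]
    calc |Real.exp (-(e ^ 2 / 2)) - (1 - e ^ 2 / 2)|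
        = |Real.exp (-(e ^ 2 / 2)) - 1 - -(e ^ 2 / 2)| := by congr 1; ring
      _ ≤ (-(e ^ 2 / 2)) ^ 2 := h
      _ = e ^ 4 / 4 := by ring
      _ ≤ e ^ 3 := by
        have : e ^ 4 ≤ e ^ 3 := pow_le_pow_of_le_one h0 h1 (by norm_num)
        have : 0 ≤ e ^ 4 := by positivity
        linarith

/-- Markov's inequality for the 4-cycle sum. -/
theorem measure_not_isQuasirandom_le {V : Type*} [Fintype V] {d : ℕ} (ε : unitInterval) {δ : ℝ}
    (hδ : 0 < δ) (hd : d * (ε : ℝ) ^ 3 ≤ δ / 2) (hn : 2 / δ ≤ Fintype.card V) :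
    binomialLaw V d (unitInterval.symm ε)
      {f | IsQuasirandom (intersectionGraph f) (Real.exp (-((ε : ℝ) ^ 2 * d / 2))) δ}ᶜ ≤
      ENNReal.ofReal ((32 * (d * (ε : ℝ) ^ 3) + 6 / Fintype.card V) / δ ^ 4) := by
  set ρ : ℝ := (1 - (ε : ℝ) ^ 2 / 2) ^ d with hρ
  have hE := integral_fourCycleSum_le (V := V) d ε
  rw [← hρ] at hE
  have hn0 : (0 : ℝ) < Fintype.card V := lt_of_lt_of_le (by positivity) hn
  have hnonneg (f : V → Code d) : 0 ≤ fourCycleSum ρ f := by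
    -- The case `S = ∅` of the Cauchy–Schwarz bound.
    have h := sum_pow_four_le (fun u v => agree (f u) (f v) - ρ) ∅
    rw [Finset.sum_empty, zero_pow four_ne_zero] at h
    exact nonneg_of_mul_nonneg_right h (by positivity)
  set n : ℝ := (Fintype.card V : ℝ)
  have hM := mul_meas_ge_le_integral_of_nonneg (ae_of_all _ hnonneg)
    (.of_finite (μ := binomialLaw V d (unitInterval.symm ε))) (δ ^ 4 * n ^ 4)
  have hsub : {f : V → Code d | IsQuasirandom (intersectionGraph f)
      (Real.exp (-((ε : ℝ) ^ 2 * d / 2))) δ}ᶜ ⊆ {f | δ ^ 4 * n ^ 4 ≤ fourCycleSum ρ f} := by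
    intro f hf
    by_contra hlt
    exact hf (isQuasirandom_of_fourCycleSum_lt hδ
      ((abs_one_sub_pow_sub_exp_le ε.2.1 ε.2.2 d).trans hd) hn (not_le.1 hlt))
  refine (measure_mono hsub).trans ?_
  rw [← ofReal_measureReal]
  refine ENNReal.ofReal_le_ofReal ?_
  rw [le_div_iff₀ (by positivity)]
  have hn4 : 0 < n ^ 4 := by positivity
  refine le_of_mul_le_mul_right ?_ hn4
  calc _ = δ ^ 4 * n ^ 4 * (binomialLaw V d (unitInterval.symm ε)).real
          {f | δ ^ 4 * n ^ 4 ≤ fourCycleSum ρ f} := by ring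
    _ ≤ _ := hM.trans hE
    _ = _ := by field_simp

end SubcubeGraph

theorem mainTheorem11 (ε : ℕ → unitInterval)
    (hε : ∃ c C : ℝ, 0 < c ∧
      ∀ᶠ d : ℕ in atTop, c ≤ (ε d : ℝ) ^ 2 * d ∧ (ε d : ℝ) ^ 2 * d ≤ C) :
    ∀ δ : ℝ, 0 < δ →
      Tendsto
        (fun x : ℕ × ℕ =>
          SubcubeGraph.binomialLaw (Fin x.2) x.1 (unitInterval.symm (ε x.1))
            {f | SubcubeGraph.IsQuasirandom (SubcubeGraph.intersectionGraph f)
              (Real.exp (-((ε x.1 : ℝ) ^ 2 * x.1 / 2))) δ})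
        (atTop ×ˢ atTop) (𝓝 1) := by
  intro δ hδ
  obtain ⟨_, C, _, hC⟩ := hε
  have hsq : Tendsto (fun d => (ε d : ℝ) ^ 2) atTop (𝓝 0) := by
    refine squeeze_zero' (.of_forall fun d => sq_nonneg _) ?_
      (tendsto_const_div_atTop_nhds_zero_nat C)
    filter_upwards [hC, eventually_gt_atTop 0] with d hd h0
    rw [le_div_iff₀ (by exact_mod_cast h0)]
    exact hd.2
  have hε0 : Tendsto (fun d => (ε d : ℝ)) atTop (𝓝 0) := by
    simpa [Real.sqrt_sq (ε _).2.1] using hsq.sqrt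
  have hcube : Tendsto (fun d : ℕ => d * (ε d : ℝ) ^ 3) atTop (𝓝 0) := by
    have hCε : Tendsto (fun d => C * (ε d : ℝ)) atTop (𝓝 0) := by
      simpa using hε0.const_mul C
    refine squeeze_zero' (.of_forall fun d => ?_) ?_ hCε
    · have := (ε d).2.1
      positivity
    · filter_upwards [hC] with d hd
      calc d * (ε d : ℝ) ^ 3 = (ε d : ℝ) ^ 2 * d * ε d := by ring
        _ ≤ C * ε d := mul_le_mul_of_nonneg_right hd.2 (ε d).2.1
  have hbound : Tendsto (fun x : ℕ × ℕ =>
      1 - ENNReal.ofReal ((32 * (x.1 * (ε x.1 : ℝ) ^ 3) + 6 / x.2) / δ ^ 4))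
      (atTop ×ˢ atTop) (𝓝 1) := by
    have h : Tendsto (fun x : ℕ × ℕ => (32 * (x.1 * (ε x.1 : ℝ) ^ 3) + 6 / x.2) / δ ^ 4)
        (atTop ×ˢ atTop) (𝓝 0) := by
      have := (((hcube.comp tendsto_fst).const_mul 32).add
        ((tendsto_const_div_atTop_nhds_zero_nat (6 : ℝ)).comp
          (tendsto_snd (f := (atTop : Filter ℕ)) (g := atTop)))).div_const (δ ^ 4)
      simpa using this
    have h' := ENNReal.tendsto_ofReal h
    rw [ENNReal.ofReal_zero] at h'
    simpa using ENNReal.Tendsto.sub (tendsto_const_nhds (x := (1 : ENNReal))) h' (.inl (by simp))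
  refine tendsto_of_tendsto_of_tendsto_of_le_of_le' hbound tendsto_const_nhds ?_
    (.of_forall fun x => prob_le_one)
  have hd := hcube.eventually (eventually_le_nhds (half_pos hδ))
  have hn := tendsto_natCast_atTop_atTop.eventually (eventually_ge_atTop (2 / δ))
  filter_upwards [hd.prod_mk hn] with x hx
  have h := SubcubeGraph.measure_not_isQuasirandom_le (V := Fin x.2) (ε x.1) hδ hx.1
    (by simpa using hx.2)
  rw [Fintype.card_fin] at h
  rw [tsub_le_iff_right, ← prob_add_prob_compl
    (μ := SubcubeGraph.binomialLaw (Fin x.2) x.1 (unitInterval.symm (ε x.1)))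
    (s := {f | SubcubeGraph.IsQuasirandom (SubcubeGraph.intersectionGraph f)
      (Real.exp (-((ε x.1 : ℝ) ^ 2 * x.1 / 2))) δ}) .of_discrete]
  gcongr
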